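/- Let $D$ be a bounded domain (a non-empty, bounded, connected open set) in $\mathbb{C}^n$ and let $x\in D$. Let $(f_i)_{i\in\mathbb{N}}$ be a sequence of injective holomorphic maps from $D$ to $\mathbb{C}^n$ such that $f_i(x)=0\in\mathbb{C}^n$ for all $i$. Suppose that $f_i$ converges, uniformly on compact subsets of $D$, to a map $f:D\to\mathbb{C}^n$. If there exists a neighbourhood $U$ of $0$ in $\mathbb{C}^n$ such that $U\subset f_i(D)$ for all $i$, then $f$ is injective. -/

import Mathlib

open Set Filter Topology

/-! The inverses of the maps `F i` send one fixed ball about `0` into the bounded set `D`, so a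
Cauchy estimate bounds their derivatives at `0` uniformly in `i`. Hence the derivatives of `F i` at
`x` are uniformly bounded below (`norm_le_mul_norm_fderiv_apply`), and the derivative of `f` at `x`
is injective. The Jacobians of the `F i` vanish nowhere by Osgood's theorem
(`injective_fderiv_of_injOn`). Hurwitz's theorem on complex lines and connectedness of `D` then make
the Jacobian of the limit vanish everywhere or nowhere (`det_fderiv_ne_zero_of_tendsto`), and `x`
excludes the former. If `f` took one value `c` at two points, a quantitative inverse function
theorem would make some `F i` take `c` near both, against its injectivity
(`injOn_of_tendsto_fderiv`).

Osgood's theorem goes by induction on the dimension. Where the derivative is nonzero, restricting to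
a level set of one component lowers the dimension (`injective_fderiv_of_ker`). So the derivative
vanishes at every zero of the Jacobian; in dimension at least two such a zero yields a curve of
zeros, on which the map is constant (`det_fderiv_ne_zero_of_singular_imp_zero`). Dimension one is
Hurwitz's theorem for divided differences (`deriv_ne_zero_of_injOn`). -/

/-! ### Hurwitz's theorem and injective functions of one variable. -/

/-- A holomorphic function on a disc that is smaller at the centre than on the boundary circle
vanishes somewhere in the disc. -/
theorem exists_zero_of_norm_center_lt {h : ℂ → ℂ} {z₀ : ℂ} {r δ : ℝ} (hr : 0 < r)
    (hd : ∀ z ∈ Metric.closedBall z₀ r, DifferentiableAt ℂ h z)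
    (hs : ∀ z ∈ Metric.sphere z₀ r, δ ≤ ‖h z‖) (hc : ‖h z₀‖ < δ) :
    ∃ z ∈ Metric.closedBall z₀ r, h z = 0 := by
  by_contra! hne
  have hδ : 0 < δ := (norm_nonneg _).trans_lt hc
  -- Without zeros, `1 / h` is holomorphic and contradicts the maximum principle.
  have hdc : DiffContOnCl ℂ (fun z => (h z)⁻¹) (Metric.ball z₀ r) := by
    refine DifferentiableOn.diffContOnCl fun z hz => ?_
    rw [closure_ball _ hr.ne'] at hz
    exact ((hd z hz).inv (hne z hz)).differentiableWithinAt
  have hle := Complex.norm_le_of_forall_mem_frontier_norm_le Metric.isBounded_ball hdc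
    (C := δ⁻¹) (fun z hz => by
      rw [frontier_ball _ hr.ne'] at hz
      rw [norm_inv]
      exact inv_anti₀ hδ (hs z hz)) (subset_closure (Metric.mem_ball_self hr))
  rw [norm_inv] at hle
  have hpos : 0 < ‖h z₀‖ := norm_pos_iff.2 (hne z₀ (Metric.mem_closedBall_self hr.le))
  exact absurd ((inv_le_inv₀ hpos hδ).1 hle) (not_le.2 hc)

/-- **Hurwitz's theorem**: if a family of holomorphic functions converges to `g` near an isolated
zero of `g`, then the members of the family eventually have zeros close to it. -/
theorem eventually_exists_zero_of_tendsto {ι : Type*} {l : Filter ι} {h : ι → ℂ → ℂ} {g : ℂ → ℂ}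
    {z₀ : ℂ} (hg₀ : g z₀ = 0) (hgc : ∀ᶠ z in 𝓝 z₀, ContinuousAt g z)
    (hg : ∀ᶠ z in 𝓝[≠] z₀, g z ≠ 0)
    (hd : ∀ᶠ p in l ×ˢ 𝓝 z₀, DifferentiableAt ℂ (h p.1) p.2)
    (hlim : ∀ᶠ z in 𝓝 z₀, Tendsto (fun p : ι × ℂ => h p.1 p.2) (l ×ˢ 𝓝 z) (𝓝 (g z)))
    {V : Set ℂ} (hV : V ∈ 𝓝 z₀) : ∀ᶠ i in l, ∃ z ∈ V, h i z = 0 := by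
  obtain ⟨pa, hpa, pb, hpb, hpab⟩ := eventually_prod_iff.1 hd
  rw [eventually_nhdsWithin_iff] at hg
  obtain ⟨r, hr, hball⟩ := Metric.nhds_basis_closedBall.mem_iff.1
    (inter_mem (inter_mem hgc hg) (inter_mem (inter_mem hpb hlim) hV))
  have hsph : IsCompact (Metric.sphere z₀ r) := isCompact_sphere z₀ r
  obtain ⟨δ, hδ, hδs⟩ : ∃ δ > 0, ∀ z ∈ Metric.sphere z₀ r, δ < ‖g z‖ := by
    obtain ⟨w, hw, hmin⟩ := hsph.exists_isMinOn (NormedSpace.sphere_nonempty.2 hr.le)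
      (f := fun z => ‖g z‖) (fun z hz =>
        (hball (Metric.sphere_subset_closedBall hz)).1.1.norm.continuousWithinAt)
    have hw0 : 0 < ‖g w‖ := norm_pos_iff.2
      ((hball (Metric.sphere_subset_closedBall hw)).1.2 (Metric.ne_of_mem_sphere hw hr.ne'))
    exact ⟨‖g w‖ / 2, by positivity, fun z hz => by have := hmin hz; simp at this; linarith⟩
  -- Joint convergence at each point of the compact sphere gives a lower bound uniform on the
  -- sphere.
  have hev : ∀ᶠ i in l, ∀ z ∈ Metric.sphere z₀ r, δ < ‖h i z‖ := by
    have hmem : {p : ι × ℂ | δ < ‖h p.1 p.2‖} ∈ l ×ˢ 𝓝ˢ (Metric.sphere z₀ r) :=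
      hsph.mem_prod_nhdsSet_of_forall fun z hz =>
        (hball (Metric.sphere_subset_closedBall hz)).2.1.2.norm.eventually (lt_mem_nhds (hδs z hz))
    obtain ⟨s, hs, t, ht, hst⟩ := mem_prod_iff.1 hmem
    filter_upwards [hs] with i hi z hz
    exact hst (mk_mem_prod hi (subset_of_mem_nhdsSet ht hz))
  have hcent : ∀ᶠ i in l, ‖h i z₀‖ < δ := by
    have h0 : Tendsto (fun p : ι × ℂ => h p.1 p.2) (l ×ˢ 𝓝 z₀) (𝓝 (g z₀)) :=
      (hball (Metric.mem_closedBall_self hr.le)).2.1.2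
    rw [hg₀] at h0
    have h1 : Tendsto (fun i => h i z₀) l (𝓝 0) :=
      h0.comp (tendsto_id.prodMk tendsto_const_nhds |>.mono_right (prod_mono le_rfl le_rfl))
    simpa using h1.norm.eventually (gt_mem_nhds (by simpa using hδ))
  filter_upwards [hpa, hev, hcent] with i h1 h2 h3
  obtain ⟨z, hz, hz0⟩ := exists_zero_of_norm_center_lt hr
    (fun z hz => hpab h1 (hball hz).2.1.1) (fun z hz => (h2 z hz).le) h3
  exact ⟨z, (hball hz).2.2, hz0⟩

/-- An injective holomorphic function of one variable has nonvanishing derivative. -/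
theorem deriv_ne_zero_of_injOn {f : ℂ → ℂ} {U : Set ℂ} (hU : IsOpen U)
    (hf : DifferentiableOn ℂ f U) (hinj : InjOn f U) {p : ℂ} (hp : p ∈ U) : deriv f p ≠ 0 := by
  intro h0
  have hfa : ∀ z ∈ U, AnalyticAt ℂ f z := fun z hz => hf.analyticAt (hU.mem_nhds hz)
  have hds : ∀ z ∈ U, ∀ w ∈ U, DifferentiableAt ℂ (dslope f z) w := fun z hz w hw =>
    (((Complex.differentiableOn_dslope (hU.mem_nhds hz)).2 hf) w hw).differentiableAt
      (hU.mem_nhds hw)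
  have hne : ∀ z ∈ U, ∀ w ∈ U, w ≠ z → dslope f z w ≠ 0 := by
    intro z hz w hw hwz hzero
    have := sub_smul_dslope f z w
    rw [hzero, smul_zero] at this
    exact hwz (hinj hw hz (sub_eq_zero.1 this.symm))
  -- Hurwitz with the base point `z` as parameter: since `f' p = 0`, injectivity makes `p` an
  -- isolated zero of `dslope f p`.
  have hev : ∀ᶠ z in 𝓝 p, ∃ w ∈ U, dslope f z w = 0 := by
    refine eventually_exists_zero_of_tendsto (l := 𝓝 p) (h := fun z => dslope f z)
      (g := dslope f p) (z₀ := p) (by rw [dslope_same, h0]) ?_ ?_ ?_ ?_ (hU.mem_nhds hp)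
    · filter_upwards [hU.mem_nhds hp] with w hw using (hds p hp w hw).continuousAt
    · filter_upwards [self_mem_nhdsWithin, nhdsWithin_le_nhds (hU.mem_nhds hp)] with w hw hwU
      exact hne p hp w hwU hw
    · filter_upwards [prod_mem_prod (hU.mem_nhds hp) (hU.mem_nhds hp)] with q hq
      exact hds _ hq.1 _ hq.2
    · filter_upwards [hU.mem_nhds hp] with w hw
      rw [← nhds_prod_eq]
      -- Joint continuity of the divided difference; on the diagonal it rests on strict
      -- differentiability.
      rcases eq_or_ne w p with rfl | hwp
      · rw [dslope_same]
        have hst := (hfa w hw).hasStrictDerivAt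
        have hdc := (hfa w hw).deriv.continuousAt
        rw [Metric.tendsto_nhds]
        intro ε hε
        have h1 := (hasStrictDerivAt_iff_hasStrictFDerivAt.1 hst).isLittleO.def (half_pos hε)
        have h2 := (Metric.tendsto_nhds.1 hdc.tendsto ε hε)
        have h3 : ∀ᶠ q : ℂ × ℂ in 𝓝 (w, w), dist (deriv f q.1) (deriv f w) < ε :=
          (continuous_fst.tendsto (w, w)).eventually h2
        filter_upwards [h1, h3] with q hq hq3
        rcases eq_or_ne q.2 q.1 with hqe | hqe
        · rw [hqe, dslope_same]; exact hq3
        · have hpos : 0 < ‖q.1 - q.2‖ := norm_pos_iff.2 (sub_ne_zero.2 hqe.symm)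
          have hsub := sub_smul_dslope f q.1 q.2
          have heq : f q.1 - f q.2 - (q.1 - q.2) * deriv f w
              = (q.1 - q.2) * (dslope f q.1 q.2 - deriv f w) := by
            simp only [smul_eq_mul] at hsub
            linear_combination hsub
          simp only [ContinuousLinearMap.toSpanSingleton_apply, smul_eq_mul] at hq
          rw [heq, norm_mul, mul_comm (‖q.1 - q.2‖)] at hq
          rw [dist_eq_norm]
          exact (le_of_mul_le_mul_right hq hpos).trans_lt (half_lt_self hε)
      · have hev : ∀ᶠ q : ℂ × ℂ in 𝓝 (p, w), (q.2 - q.1)⁻¹ * (f q.2 - f q.1) = dslope f q.1 q.2 := by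
          have : ∀ᶠ q : ℂ × ℂ in 𝓝 (p, w), q.2 ≠ q.1 :=
            (isOpen_ne_fun continuous_snd continuous_fst).mem_nhds hwp
          filter_upwards [this] with q hq
          rw [dslope_of_ne _ hq, slope_def_field]
          ring
        refine Tendsto.congr' hev ?_
        rw [dslope_of_ne _ hwp, slope_def_field, div_eq_inv_mul]
        have c1 : Tendsto (fun q : ℂ × ℂ => f q.1) (𝓝 (p, w)) (𝓝 (f p)) :=
          (hfa p hp).continuousAt.tendsto.comp (continuous_fst.tendsto (p, w))
        have c2 : Tendsto (fun q : ℂ × ℂ => f q.2) (𝓝 (p, w)) (𝓝 (f w)) :=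
          (hfa w hw).continuousAt.tendsto.comp (continuous_snd.tendsto (p, w))
        exact (((continuous_snd.sub continuous_fst).tendsto (p, w)).inv₀
          (sub_ne_zero.2 hwp)).mul (c2.sub c1)
  -- Injectivity forbids zeros off the diagonal, so the zero found is `w = z`.
  have hder : ∀ᶠ z in 𝓝 p, deriv f z = 0 := by
    filter_upwards [hev, hU.mem_nhds hp] with z ⟨w, hw, hzw⟩ hz
    by_cases hwz : w = z
    · rw [hwz, dslope_same] at hzw; exact hzw
    · exact absurd hzw (hne z hz w hw hwz)
  obtain ⟨r, hr, hball⟩ := Metric.nhds_basis_ball.mem_iff.1 (inter_mem hder (hU.mem_nhds hp))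
  have hconst : f (p + (r / 2 : ℝ)) = f p := by
    refine (convex_ball p r).is_const_of_fderivWithin_eq_zero (𝕜 := ℂ)
      (hf.mono fun z hz => (hball hz).2) (fun z hz => ?_) ?_ (Metric.mem_ball_self hr)
    · rw [fderivWithin_of_isOpen Metric.isOpen_ball hz]
      ext
      simpa using (hball hz).1
    · simp [abs_of_pos hr, hr]
  have hmem : p + (r / 2 : ℝ) ∈ Metric.ball p r := by simp [abs_of_pos hr, hr]
  have := hinj (hball hmem).2 hp hconst
  simp [hr.ne'] at this

/-! ### Cauchy estimates and Weierstrass' theorem in several variables. -/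

section SeveralVariables

variable {E F : Type*} [NormedAddCommGroup E] [NormedSpace ℂ E]
  [NormedAddCommGroup F] [NormedSpace ℂ F]

/-- **Cauchy estimate** for the Fréchet derivative of a bounded holomorphic map. -/
theorem norm_fderiv_le_of_norm_le {f : E → F} {c : E} {R M : ℝ} (hR : 0 < R)
    (hd : DifferentiableOn ℂ f (Metric.ball c R)) (hM : ∀ z ∈ Metric.ball c R, ‖f z‖ ≤ M) :
    ‖fderiv ℂ f c‖ ≤ 2 * M / R := by
  -- The factor 2 arises because the image is enclosed in a ball centred at `f c`, not at `0`.
  refine Complex.norm_fderiv_le_div_of_mapsTo_ball hd (fun z hz => ?_) hR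
  rw [mem_closedBall_iff_norm]
  refine (norm_sub_le _ _).trans ?_
  linarith [hM z hz, hM c (Metric.mem_ball_self hR)]

/-- A holomorphic map is bounded, together with its derivative, near every point. -/
theorem exists_ball_norm_le_and_norm_fderiv_le {f : E → F} {U : Set E} (hU : IsOpen U)
    (hf : DifferentiableOn ℂ f U) {c : E} (hc : c ∈ U) :
    ∃ R > 0, ∃ M > 0, Metric.ball c R ⊆ U ∧ ∀ z ∈ Metric.ball c R, ‖f z‖ ≤ M ∧
      ‖fderiv ℂ f z‖ ≤ M := by
  have hca : ContinuousAt f c := ((hf c hc).differentiableAt (hU.mem_nhds hc)).continuousAt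
  obtain ⟨R, hR, hball⟩ := Metric.nhds_basis_ball.mem_iff.1
    (inter_mem (hU.mem_nhds hc) (hca.norm.preimage_mem_nhds (Iio_mem_nhds (lt_add_one ‖f c‖))))
  set M := ‖f c‖ + 1
  have hM : ∀ z ∈ Metric.ball c R, ‖f z‖ ≤ M := fun z hz => le_of_lt (hball hz).2
  have hM0 : 0 < M := by positivity
  refine ⟨R / 2, half_pos hR, max M (2 * M / (R / 2)), lt_max_of_lt_left hM0,
    (Metric.ball_subset_ball (by linarith)).trans fun z hz => (hball hz).1, fun z hz => ?_⟩
  have hsub : Metric.ball z (R / 2) ⊆ Metric.ball c R :=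
    Metric.ball_subset_ball' (by rw [Metric.mem_ball] at hz; linarith)
  exact ⟨(hM z (Metric.ball_subset_ball (by linarith) hz)).trans (le_max_left _ _),
    (norm_fderiv_le_of_norm_le (half_pos hR) (hf.mono fun w hw => (hball (hsub hw)).1)
      fun w hw => hM w (hsub hw)).trans (le_max_right _ _)⟩

/-- The Fréchet derivative of a holomorphic map is continuous. -/
theorem continuousAt_fderiv_of_differentiableOn {f : E → F} {U : Set E} (hU : IsOpen U)
    (hf : DifferentiableOn ℂ f U) {c : E} (hc : c ∈ U) : ContinuousAt (fderiv ℂ f) c := by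
  obtain ⟨R, hR, C, hC0, hball, hC⟩ := exists_ball_norm_le_and_norm_fderiv_le hU hf hc
  have hd : ∀ z ∈ Metric.ball c R, DifferentiableAt ℂ f z := fun z hz =>
    (hf z (hball hz)).differentiableAt (hU.mem_nhds (hball hz))
  -- Cauchy estimate for `z ↦ f (z + (v - c)) - f z`, which is at most `C * ‖v - c‖` by the mean
  -- value inequality.
  have hlip : ∀ v ∈ Metric.ball c (R / 2), ‖fderiv ℂ f v - fderiv ℂ f c‖
      ≤ 2 * (C * ‖v - c‖) / (R / 2) := by
    intro v hv
    rw [mem_ball_iff_norm] at hv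
    have h1 : ∀ z ∈ Metric.ball c (R / 2), z + (v - c) ∈ Metric.ball c R := by
      intro z hz
      rw [mem_ball_iff_norm] at hz ⊢
      calc ‖z + (v - c) - c‖ = ‖(z - c) + (v - c)‖ := by congr 1; abel
        _ ≤ ‖z - c‖ + ‖v - c‖ := norm_add_le _ _
        _ < R := by linarith
    have h2 : Metric.ball c (R / 2) ⊆ Metric.ball c R :=
      Metric.ball_subset_ball (by linarith)
    have hshift : ∀ z ∈ Metric.ball c (R / 2),
        HasFDerivAt (fun z => f (z + (v - c)) - f z)
          (fderiv ℂ f (z + (v - c)) - fderiv ℂ f z) z := by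
      intro z hz
      exact ((hasFDerivAt_comp_add_right (v - c)).2 (hd _ (h1 z hz)).hasFDerivAt).sub
        (hd z (h2 hz)).hasFDerivAt
    have hcc : c ∈ Metric.ball c (R / 2) := Metric.mem_ball_self (by linarith)
    have h5 := norm_fderiv_le_of_norm_le (f := fun z => f (z + (v - c)) - f z) (c := c)
      (R := R / 2) (M := C * ‖v - c‖) (by linarith)
      (fun z hz => (hshift z hz).differentiableAt.differentiableWithinAt) (fun z hz => by
        have := (convex_ball c R).norm_image_sub_le_of_norm_fderiv_le (𝕜 := ℂ) (f := f)
          (fun w hw => hd w hw) (fun w hw => (hC w hw).2) (h2 hz) (h1 z hz)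
        simpa using this)
    rw [(hshift c hcc).fderiv] at h5
    simpa using h5
  rw [ContinuousAt, tendsto_iff_norm_sub_tendsto_zero]
  refine squeeze_zero' (Eventually.of_forall fun _ => norm_nonneg _)
    (eventually_of_mem (Metric.ball_mem_nhds c (by linarith : 0 < R / 2)) hlip) ?_
  have : Continuous fun v : E => 2 * (C * ‖v - c‖) / (R / 2) := by fun_prop
  simpa using this.tendsto c

theorem hasStrictFDerivAt_of_differentiableOn {f : E → F} {U : Set E} (hU : IsOpen U)
    (hf : DifferentiableOn ℂ f U) {c : E} (hc : c ∈ U) :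
    HasStrictFDerivAt f (fderiv ℂ f c) c :=
  hasStrictFDerivAt_of_hasFDerivAt_of_continuousAt
    (eventually_of_mem (hU.mem_nhds hc) fun z hz =>
      ((hf z hz).differentiableAt (hU.mem_nhds hz)).hasFDerivAt)
    (continuousAt_fderiv_of_differentiableOn hU hf hc)

theorem contDiffAt_one_of_differentiableOn {f : E → F} {U : Set E} (hU : IsOpen U)
    (hf : DifferentiableOn ℂ f U) {c : E} (hc : c ∈ U) : ContDiffAt ℂ 1 f c := by
  refine ContDiffOn.contDiffAt (s := U) ?_ (hU.mem_nhds hc)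
  have := (contDiffOn_succ_iff_fderiv_of_isOpen (𝕜 := ℂ) (f := f) (n := 0) hU).2
    ⟨hf, by simp, contDiffOn_zero.2 fun z hz =>
      (continuousAt_fderiv_of_differentiableOn hU hf hz).continuousWithinAt⟩
  simpa using this

/-- Weierstrass' theorem in several variables: the derivatives of a family of holomorphic maps that
converges uniformly on a neighbourhood of each point converge to the derivative of the limit. -/
theorem hasFDerivAt_and_tendsto_fderiv_of_tendstoUniformlyOn [CompleteSpace F] {ι : Type*}
    {l : Filter ι} [l.NeBot] {G : ι → E → F} {g : E → F} {c : E} {R : ℝ} (hR : 0 < R)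
    (hG : ∀ᶠ i in l, DifferentiableOn ℂ (G i) (Metric.ball c R))
    (hlim : TendstoUniformlyOn G g l (Metric.ball c R)) :
    DifferentiableAt ℂ g c ∧
      Tendsto (fun p : ι × E => fderiv ℂ (G p.1) p.2) (l ×ˢ 𝓝 c) (𝓝 (fderiv ℂ g c)) := by
  have hcauchy : UniformCauchySeqOn (fun i => fderiv ℂ (G i)) l (Metric.ball c (R / 2)) := by
    intro u hu
    obtain ⟨ε, hε, hεu⟩ := Metric.mem_uniformity_dist.1 hu
    -- With this tolerance the Cauchy estimate on balls of radius `R / 2` gives `ε / 2`.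
    have h1 := hlim.uniformCauchySeqOn _
      (Metric.dist_mem_uniformity (show 0 < ε * (R / 2) / 4 by positivity))
    filter_upwards [h1, (hG.prod_mk hG)] with q hq hqG z hz
    have hsub : Metric.ball z (R / 2) ⊆ Metric.ball c R :=
      Metric.ball_subset_ball' (by rw [Metric.mem_ball] at hz; linarith)
    have hd : ∀ i, DifferentiableOn ℂ (G i) (Metric.ball c R) → ∀ w ∈ Metric.ball z (R / 2),
        DifferentiableAt ℂ (G i) w := fun i hi w hw =>
      (hi w (hsub hw)).differentiableAt (Metric.isOpen_ball.mem_nhds (hsub hw))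
    have hzz := Metric.mem_ball_self (x := z) (half_pos hR)
    have h2 := norm_fderiv_le_of_norm_le (f := fun w => G q.1 w - G q.2 w) (c := z)
      (M := ε * (R / 2) / 4) (half_pos hR)
      (fun w hw => ((hd _ hqG.1 w hw).sub (hd _ hqG.2 w hw)).differentiableWithinAt)
      (fun w hw => by simpa [dist_eq_norm] using (hq w (hsub hw)).le)
    rw [fderiv_fun_sub (hd _ hqG.1 z hzz) (hd _ hqG.2 z hzz)] at h2
    refine hεu ?_
    rw [dist_eq_norm]
    refine h2.trans_lt ?_
    rw [div_lt_iff₀ (half_pos hR)]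
    nlinarith [mul_pos hε hR]
  have hptw : ∀ z ∈ Metric.ball c (R / 2), ∃ A, Tendsto (fun i => fderiv ℂ (G i) z) l (𝓝 A) :=
    fun z hz => CompleteSpace.complete (hcauchy.cauchy_map hz)
  choose! g' hg' using hptw
  have hunif := hcauchy.tendstoUniformlyOn_of_tendsto hg'
  have hder : ∀ z ∈ Metric.ball c (R / 2), HasFDerivAt g (g' z) z := by
    intro z hz
    have hzU := Metric.isOpen_ball.mem_nhds hz
    refine hasFDerivAt_of_tendstoUniformlyOnFilter (l := l) (f := G)
      (f' := fun i => fderiv ℂ (G i)) (g' := g') ?_ ?_ ?_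
    · exact hunif.tendstoUniformlyOnFilter.mono_right (le_principal_iff.2 hzU)
    · filter_upwards [hG.prod_mk hzU] with q hq
      have hqR := Metric.ball_subset_ball (by linarith : R / 2 ≤ R) hq.2
      exact ((hq.1 _ hqR).differentiableAt (Metric.isOpen_ball.mem_nhds hqR)).hasFDerivAt
    · filter_upwards [hzU] with w hw
      exact hlim.tendsto_at (Metric.ball_subset_ball (by linarith) hw)
  have hcc := Metric.mem_ball_self (x := c) (half_pos hR)
  refine ⟨(hder c hcc).differentiableAt, ?_⟩
  have hcont : ContinuousAt (fderiv ℂ g) c :=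
    continuousAt_fderiv_of_differentiableOn Metric.isOpen_ball
      (fun z hz => (hder z hz).differentiableAt.differentiableWithinAt) hcc
  have hu2 : TendstoUniformlyOnFilter (fun i => fderiv ℂ (G i)) (fderiv ℂ g) l (𝓝 c) :=
    ((hunif.congr_right fun z hz => (hder z hz).fderiv.symm).tendstoUniformlyOnFilter).mono_right
      (le_principal_iff.2 (Metric.isOpen_ball.mem_nhds hcc))
  rw [Metric.tendsto_nhds]
  intro ε hε
  have h1 := Metric.tendstoUniformlyOnFilter_iff.1 hu2 (ε / 2) (half_pos hε)
  have h2 := (Metric.tendsto_nhds.1 hcont (ε / 2) (half_pos hε)).prod_inr l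
  filter_upwards [h1, h2] with q hq1 hq2
  rw [dist_comm] at hq1
  linarith [dist_triangle (fderiv ℂ (G q.1) q.2) (fderiv ℂ g q.2) (fderiv ℂ g c)]

/-- Directional derivatives of holomorphic maps are holomorphic. -/
theorem differentiableOn_fderiv_apply [CompleteSpace F] {f : E → F} {U : Set E} (hU : IsOpen U)
    (hf : DifferentiableOn ℂ f U) (v : E) : DifferentiableOn ℂ (fun z => fderiv ℂ f z v) U := by
  intro c hc
  refine DifferentiableAt.differentiableWithinAt ?_
  obtain ⟨R, hR, M, hM0, hball, hM⟩ := exists_ball_norm_le_and_norm_fderiv_le hU hf hc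
  have hd : ∀ z ∈ Metric.ball c R, DifferentiableAt ℂ f z := fun z hz =>
    (hf z (hball hz)).differentiableAt (hU.mem_nhds (hball hz))
  have hR2 : 0 < R / 2 := half_pos hR
  have hsub : ∀ z ∈ Metric.ball c (R / 2), Metric.ball z (R / 2) ⊆ Metric.ball c R :=
    fun z hz => Metric.ball_subset_ball' (by rw [Metric.mem_ball] at hz; linarith)
  -- `K` bounds the increment of `f` minus its linear part; being `o(‖w - z‖)`, this remainder is
  -- quadratic by the higher-order Schwarz lemma (`n := 1` gives exponent 2).
  obtain ⟨K, hK⟩ : ∃ K, K = 2 * M + M * (R / 2) := ⟨_, rfl⟩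
  have hquad : ∀ z ∈ Metric.ball c (R / 2), ∀ w ∈ Metric.ball z (R / 2),
      ‖f w - f z - fderiv ℂ f z (w - z)‖ ≤ K * (‖w - z‖ / (R / 2)) ^ 2 := by
    intro z hz w hw
    have hzR := hsub z hz (Metric.mem_ball_self hR2)
    have := Complex.dist_le_mul_div_pow_of_mapsTo_ball_of_isLittleO (n := 1)
      (f := fun w => f w - fderiv ℂ f z (w - z)) (c := z) (R₁ := R / 2) (R₂ := K) (z := w)
      (fun w hw => ((hd w (hsub z hz hw)).sub (by fun_prop)).differentiableWithinAt)
      (fun w hw => by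
        rw [mem_closedBall_iff_norm]
        rw [mem_ball_iff_norm] at hw
        have h1 := (hM w (hsub z hz (mem_ball_iff_norm.2 hw))).1
        have h2 := (hM z hzR).1
        have h3 : ‖fderiv ℂ f z (w - z)‖ ≤ M * (R / 2) :=
          ((fderiv ℂ f z).le_opNorm _).trans
            (mul_le_mul (hM z hzR).2 hw.le (norm_nonneg _) hM0.le)
        have h4 : f w - fderiv ℂ f z (w - z) - (f z - fderiv ℂ f z (z - z))
            = (f w - f z) - fderiv ℂ f z (w - z) := by simp; abel
        rw [h4]
        refine (norm_sub_le _ _).trans ?_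
        linarith [norm_sub_le (f w) (f z)])
      (by
        have := (hd z hzR).hasFDerivAt.isLittleO
        simp only [pow_one]
        refine (this.congr_left fun w => ?_).norm_right
        simp; abel) hw
    simpa [dist_eq_norm, sub_right_comm] using this
  have hshift : ∀ᶠ t in 𝓝[≠] (0 : ℂ), t ≠ 0 ∧ ‖t • v‖ < R / 2 := by
    refine Eventually.and self_mem_nhdsWithin (nhdsWithin_le_nhds ?_)
    have : Continuous fun t : ℂ => ‖t • v‖ := by fun_prop
    exact this.continuousAt.preimage_mem_nhds (Iio_mem_nhds (by simpa using hR2))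
  -- The directional derivative is a locally uniform limit of holomorphic difference quotients.
  refine (hasFDerivAt_and_tendsto_fderiv_of_tendstoUniformlyOn (l := 𝓝[≠] (0 : ℂ))
    (G := fun t z => t⁻¹ • (f (z + t • v) - f z)) hR2 ?_ ?_).1
  · filter_upwards [hshift] with t ht z hz
    have hmem : z + t • v ∈ Metric.ball c R := hsub z hz (by simpa using ht.2)
    have h1 : DifferentiableAt ℂ (fun z => f (z + t • v)) z :=
      ((hasFDerivAt_comp_add_right (t • v)).2 (hd _ hmem).hasFDerivAt).differentiableAt
    exact ((h1.sub (hd z (hsub z hz (Metric.mem_ball_self hR2)))).const_smul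
      t⁻¹).differentiableWithinAt
  · rw [Metric.tendstoUniformlyOn_iff]
    intro ε hε
    have hsmall : ∀ᶠ t in 𝓝[≠] (0 : ℂ), K * (‖v‖ / (R / 2)) ^ 2 * ‖t‖ < ε := by
      have : Continuous fun t : ℂ => K * (‖v‖ / (R / 2)) ^ 2 * ‖t‖ := by fun_prop
      exact nhdsWithin_le_nhds
        (this.continuousAt.preimage_mem_nhds (Iio_mem_nhds (by simpa using hε)))
    filter_upwards [hshift, hsmall] with t ht hts z hz
    refine lt_of_le_of_lt ?_ hts
    have hq := hquad z hz (z + t • v) (by simpa using ht.2)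
    have ht0 : 0 < ‖t‖ := norm_pos_iff.2 ht.1
    have heq : fderiv ℂ f z v - t⁻¹ • (f (z + t • v) - f z)
        = -(t⁻¹ • (f (z + t • v) - f z - fderiv ℂ f z (z + t • v - z))) := by
      rw [add_sub_cancel_left, map_smul, smul_sub _ _ (t • _), inv_smul_smul₀ ht.1]
      abel
    rw [dist_eq_norm, heq, norm_neg, norm_smul, norm_inv]
    rw [inv_mul_le_iff₀ ht0]
    refine hq.trans (le_of_eq ?_)
    rw [add_sub_cancel_left, norm_smul]
    ring

/-- The Jacobian determinant of a holomorphic map is holomorphic. -/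
theorem differentiableOn_det_fderiv [FiniteDimensional ℂ E] {f : E → E} {U : Set E}
    (hU : IsOpen U) (hf : DifferentiableOn ℂ f U) :
    DifferentiableOn ℂ (fun z => (fderiv ℂ f z).det) U := by
  have : CompleteSpace E := FiniteDimensional.complete ℂ E
  let b := Module.finBasis ℂ E
  have hdet : ∀ z, (fderiv ℂ f z).det
      = ∑ σ : Equiv.Perm (Fin (Module.finrank ℂ E)), Equiv.Perm.sign σ •
        ∏ i, (b.coord (σ i)).toContinuousLinearMap (fderiv ℂ f z (b i)) := by
    intro z
    rw [ContinuousLinearMap.det, ← LinearMap.det_toMatrix b, Matrix.det_apply]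
    simp [LinearMap.toMatrix_apply]
  simp_rw [hdet]
  refine DifferentiableOn.fun_sum fun σ _ => DifferentiableOn.const_smul ?_ _
  have hcoord : ∀ i, DifferentiableOn ℂ
      (fun z => (b.coord (σ i)).toContinuousLinearMap (fderiv ℂ f z (b i))) U := fun i =>
    ((b.coord (σ i)).toContinuousLinearMap.differentiable).comp_differentiableOn
    (differentiableOn_fderiv_apply hU hf (b i))
  exact fun z hz => (HasFDerivWithinAt.finsetProd fun i _ =>
    (hcoord i z hz).hasFDerivWithinAt).differentiableWithinAt

end SeveralVariables

/-! ### Osgood's theorem: the two induction steps. -/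

section Osgood

variable {E F : Type*} [NormedAddCommGroup E] [NormedSpace ℂ E]
  [NormedAddCommGroup F] [NormedSpace ℂ F]

/-- Identity theorem along a complex line meeting a convex open set. -/
theorem eq_zero_of_eventually_eq_zero_on_line {J : E → ℂ} {B : Set E} (hBo : IsOpen B)
    (hBc : Convex ℝ B) (hJ : DifferentiableOn ℂ J B) {p q : E} (hp : p ∈ B) (hq : q ∈ B)
    (h : ∀ᶠ t in 𝓝 (0 : ℂ), J (p + t • (q - p)) = 0) : J q = 0 := by
  have hcont : Continuous fun t : ℂ => p + t • (q - p) := by fun_prop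
  have hdiff : Differentiable ℂ fun t : ℂ => p + t • (q - p) := by fun_prop
  set T := (fun t : ℂ => p + t • (q - p)) ⁻¹' B
  have hTo : IsOpen T := hBo.preimage hcont
  have hTc : Convex ℝ T := by
    intro s hs t ht a b ha hb hab
    have := hBc hs ht ha hb hab
    have heq : a • (p + s • (q - p)) + b • (p + t • (q - p))
        = p + (a • s + b • t) • (q - p) := by
      rw [add_smul, smul_add, smul_add, smul_assoc, smul_assoc, add_add_add_comm, ← add_smul, hab,
        one_smul]
    rwa [heq] at this
  have han : AnalyticOnNhd ℂ (fun t : ℂ => J (p + t • (q - p))) T :=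
    (hJ.comp hdiff.differentiableOn (mapsTo_preimage _ _)).analyticOnNhd hTo
  have h0 : (0 : ℂ) ∈ T := by simpa [T] using hp
  have h1 : (1 : ℂ) ∈ T := by simpa [T] using hq
  simpa using han.eqOn_zero_of_preconnected_of_eventuallyEq_zero hTc.isPreconnected h0 h h1

theorem differentiableOn_iterate_fderiv_apply {J : E → ℂ} {U : Set E} (hU : IsOpen U)
    (hJ : DifferentiableOn ℂ J U) (e : E) (m : ℕ) :
    DifferentiableOn ℂ ((fun g z => fderiv ℂ g z e)^[m] J) U := by
  induction m with
  | zero => exact hJ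
  | succ m ih =>
    rw [Function.iterate_succ_apply']
    exact differentiableOn_fderiv_apply hU ih e

/-- If a holomorphic function does not vanish identically on a line near a point, then one of its
iterated derivatives along that line is nonzero at the point. -/
theorem exists_iterate_fderiv_apply_ne_zero {J : E → ℂ} {U : Set E} (hU : IsOpen U)
    (hJ : DifferentiableOn ℂ J U) {p e : E} (hp : p ∈ U)
    (hne : ¬ ∀ᶠ t in 𝓝 (0 : ℂ), J (p + t • e) = 0) :
    ∃ m, (fun g z => fderiv ℂ g z e)^[m] J p ≠ 0 := by
  by_contra! hall
  apply hne
  have hdiff : Differentiable ℂ fun t : ℂ => p + t • e := by fun_prop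
  set T := (fun t : ℂ => p + t • e) ⁻¹' U
  have hTo : IsOpen T := hU.preimage hdiff.continuous
  have h0 : (0 : ℂ) ∈ T := by simpa [T] using hp
  have han : AnalyticAt ℂ (fun t : ℂ => J (p + t • e)) 0 :=
    (hJ.comp hdiff.differentiableOn (mapsTo_preimage _ _)).analyticAt (hTo.mem_nhds h0)
  have hiter : ∀ m, ∀ t ∈ T, iteratedDeriv m (fun t : ℂ => J (p + t • e)) t
      = (fun g z => fderiv ℂ g z e)^[m] J (p + t • e) := by
    intro m
    induction m with
    | zero => intro t _; simp
    | succ m ih =>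
      intro t ht
      rw [iteratedDeriv_succ, Function.iterate_succ_apply',
        (show _ =ᶠ[𝓝 t] _ from eventually_of_mem (hTo.mem_nhds ht) ih).deriv_eq]
      have h1 : HasDerivAt (fun t : ℂ => p + t • e) e t := by
        simpa using ((hasDerivAt_id t).smul_const e).const_add p
      exact ((((differentiableOn_iterate_fderiv_apply hU hJ e m) _ ht).differentiableAt
        (hU.mem_nhds ht)).hasFDerivAt.comp_hasDerivAt t h1).deriv
  rw [← analyticOrderAt_eq_top, ENat.eq_top_iff_forall_ge]
  intro m
  rw [natCast_le_analyticOrderAt_iff_iteratedDeriv_eq_zero han]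
  intro i _
  rw [hiter i 0 h0, zero_smul, add_zero, hall i]

/-- Induction step for Osgood's theorem at a point where the derivative does not vanish: it
suffices to know the theorem on the kernel of a component of the derivative. -/
theorem injective_fderiv_of_ker [FiniteDimensional ℂ E] {f : E → F} {U : Set E} (hU : IsOpen U)
    (hf : DifferentiableOn ℂ f U) (hinj : InjOn f U) {p : E} (hp : p ∈ U) {e : E} {l : F →L[ℂ] ℂ}
    (he : l (fderiv ℂ f p e) = 1)
    (hker : ∀ (V : Set (l ∘L fderiv ℂ f p).ker) (g : (l ∘L fderiv ℂ f p).ker → l.ker), IsOpen V →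
      DifferentiableOn ℂ g V → InjOn g V → ∀ y ∈ V, Function.Injective (fderiv ℂ g y)) :
    Function.Injective (fderiv ℂ f p) := by
  set A := fderiv ℂ f p
  set K := (l ∘L A).ker
  have : CompleteSpace E := FiniteDimensional.complete ℂ E
  let L : K × ℂ →L[ℂ] E := K.subtypeL.coprod (ContinuousLinearMap.toSpanSingleton ℂ e)
  have hL : ∀ y t, L (y, t) = y + t • e := fun y t => by simp [L]
  let φ : K × ℂ → ℂ := fun q => l (f (p + L q))
  have hfp : HasFDerivAt f A (p + L 0) := by
    rw [map_zero, add_zero]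
    exact ((hf p hp).differentiableAt (hU.mem_nhds hp)).hasFDerivAt
  have hφd : HasFDerivAt φ (l ∘L (A ∘L L)) 0 :=
    l.hasFDerivAt.comp _ (hfp.comp (f := fun q => p + L q) 0 (L.hasFDerivAt.const_add p))
  have hφ : ContDiffAt ℂ 1 φ 0 := by
    have h1 : ContDiffAt ℂ 1 f (p + L 0) := by
      rw [map_zero, add_zero]; exact contDiffAt_one_of_differentiableOn hU hf hp
    exact l.contDiff.contDiffAt.comp _ (h1.comp (f := fun q => p + L q) 0
      (contDiffAt_const.add L.contDiff.contDiffAt))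
  -- The partial derivative along `e` is `l (A e) = 1`, so the level set of `l ∘ f` through `p` is
  -- locally a graph over `K`.
  have hinv : (fderiv ℂ φ 0 ∘L ContinuousLinearMap.inr ℂ K ℂ).IsInvertible := by
    refine ⟨ContinuousLinearEquiv.refl ℂ ℂ, ?_⟩
    rw [hφd.fderiv]
    ext
    simp [hL, he]
  obtain ⟨ψ, hψ0, hψd, hψ⟩ : ∃ ψ : K → ℂ, ψ 0 = 0 ∧ ContDiffAt ℂ 1 ψ 0 ∧
      ∀ᶠ y in 𝓝 0, φ (y, ψ y) = φ 0 :=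
    ⟨hφ.implicitFunction one_ne_zero hinv, hφ.implicitFunction_apply_self one_ne_zero hinv,
      hφ.contDiffAt_implicitFunction one_ne_zero hinv,
      hφ.eventually_apply_implicitFunction one_ne_zero hinv⟩
  let γ : K → E := fun y => p + L (y, ψ y)
  have hγ0 : γ 0 = p := by simp only [γ, hψ0]; exact (congrArg _ (map_zero L)).trans (add_zero p)
  have hγd : ∀ y, DifferentiableAt ℂ ψ y →
      HasFDerivAt γ (L ∘L (ContinuousLinearMap.id ℂ K).prod (fderiv ℂ ψ y)) y := fun y hy =>
    (L.hasFDerivAt.comp y ((hasFDerivAt_id y).prodMk hy.hasFDerivAt)).const_add p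
  have hψd' : ∀ᶠ y in 𝓝 0, DifferentiableAt ℂ ψ y :=
    (hψd.eventually (by simp)).mono fun y hy => hy.differentiableAt one_ne_zero
  have hγU : ∀ᶠ y in 𝓝 0, γ y ∈ U :=
    (hγd 0 hψd'.self_of_nhds).continuousAt.preimage_mem_nhds (hU.mem_nhds (by rwa [hγ0]))
  obtain ⟨V, hV, hVo, hV0⟩ := mem_nhds_iff.1 (inter_mem (inter_mem hψd' hγU) hψ)
  -- Projection onto `ker l` along `A e`; it loses no information on the level set, where `l ∘ f` is
  -- constant.
  let π : F →L[ℂ] l.ker :=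
    (ContinuousLinearMap.id ℂ F - l.smulRight (A e)).codRestrict l.ker (fun w => by
      simp [he])
  have hπ : ∀ w, (π w : F) = w - l w • A e := fun w => rfl
  have hfγ : ∀ y ∈ V, HasFDerivAt (fun y => π (f (γ y)))
      (π ∘L (fderiv ℂ f (γ y) ∘L
        (L ∘L (ContinuousLinearMap.id ℂ K).prod (fderiv ℂ ψ y)))) y := fun y hy =>
    π.hasFDerivAt.comp y ((((hf _ (hV hy).1.2).differentiableAt
      (hU.mem_nhds (hV hy).1.2)).hasFDerivAt).comp y (hγd y (hV hy).1.1))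
  have hφ0 : ∀ y ∈ V, l (f (γ y)) = φ 0 := fun y hy => (hV hy).2
  have hdg := hker V (fun y => π (f (γ y))) hVo
    (fun y hy => (hfγ y hy).differentiableAt.differentiableWithinAt)
    (fun y hy y' hy' h => by
      have h1 := congrArg (Subtype.val) h
      rw [hπ, hπ, hφ0 y hy, hφ0 y' hy'] at h1
      have h2 := add_left_cancel (hinj (hV hy).1.2 (hV hy').1.2 (sub_left_injective h1))
      rw [hL, hL] at h2
      have hy0 : l (A y) = 0 := y.2
      have hy0' : l (A y') = 0 := y'.2
      have h3 := congrArg (fun w => l (A w)) h2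
      simp only [map_add, map_smul, hy0, hy0', he, smul_eq_mul, mul_one, zero_add] at h3
      rw [h3] at h2
      exact Subtype.ext (add_right_cancel h2)) 0 hV0
  rw [(hfγ 0 hV0).fderiv, hγ0] at hdg
  rw [injective_iff_map_eq_zero]
  intro u hu
  have huK : u ∈ K := by simp [K, hu]
  -- The tangent vector over `u` is `u + t • e`; `A` kills `u` and `π` kills `A e`.
  have h0 : (⟨u, huK⟩ : K) = 0 := by
    refine (injective_iff_map_eq_zero _).1 hdg _ (Subtype.ext ?_)
    change (π (A (L (⟨u, huK⟩, _))) : F) = 0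
    rw [hπ, hL]
    simp [hu, he]
  exact congrArg Subtype.val h0

/-- Induction step for Osgood's theorem in dimension at least two, when the derivative vanishes
at all its singular points. -/
theorem det_fderiv_ne_zero_of_singular_imp_zero [FiniteDimensional ℂ E]
    (hE : 1 < Module.finrank ℂ E) {f : E → E}
    {U : Set E} (hU : IsOpen U) (hf : DifferentiableOn ℂ f U) (hinj : InjOn f U)
    (hsing : ∀ z ∈ U, (fderiv ℂ f z).det = 0 → fderiv ℂ f z = 0) {p : E} (hp : p ∈ U) :
    (fderiv ℂ f p).det ≠ 0 := by
  intro hp0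
  have : CompleteSpace E := FiniteDimensional.complete ℂ E
  have : Nontrivial E := Module.nontrivial_of_finrank_pos (R := ℂ) (by omega)
  set J : E → ℂ := fun z => (fderiv ℂ f z).det
  have hJ : DifferentiableOn ℂ J U := differentiableOn_det_fderiv hU hf
  have hfd : ∀ z ∈ U, DifferentiableAt ℂ f z := fun z hz =>
    (hf z hz).differentiableAt (hU.mem_nhds hz)
  obtain ⟨e, m₀, hm₀⟩ : ∃ e : E, ∃ m, (fun g z => fderiv ℂ g z e)^[m] J p ≠ 0 := by
    obtain ⟨r, hr, hball⟩ := Metric.nhds_basis_ball.mem_iff.1 (hU.mem_nhds hp)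
    obtain ⟨q, hq, hJq⟩ : ∃ q ∈ Metric.ball p r, J q ≠ 0 := by
      by_contra! hall
      obtain ⟨v, hv⟩ := exists_ne (0 : E)
      have hv0 : 0 < ‖v‖ := norm_pos_iff.2 hv
      obtain ⟨c, hc0, hc⟩ : ∃ c : ℂ, c ≠ 0 ∧ p + c • v ∈ Metric.ball p r := by
        refine ⟨(r / 2 / ‖v‖ : ℝ), by simp [hr.ne', hv], ?_⟩
        rw [mem_ball_iff_norm, add_sub_cancel_left, norm_smul, Complex.norm_real,
          Real.norm_of_nonneg (by positivity), div_mul_cancel₀ _ hv0.ne']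
        linarith
      have hpp := Metric.mem_ball_self (x := p) hr
      have hconst : f (p + c • v) = f p := by
        refine (convex_ball p r).is_const_of_fderivWithin_eq_zero (𝕜 := ℂ)
          (hf.mono hball) (fun z hz => ?_) hc hpp
        rw [fderivWithin_of_isOpen Metric.isOpen_ball hz]
        exact hsing z (hball hz) (hall z hz)
      simpa [hc0, hv] using hinj (hball hc) (hball hpp) hconst
    refine ⟨q - p, exists_iterate_fderiv_apply_ne_zero hU hJ hp fun h => hJq ?_⟩
    exact eq_zero_of_eventually_eq_zero_on_line Metric.isOpen_ball (convex_ball p r)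
      (hJ.mono hball) (Metric.mem_ball_self hr) hq h
  -- Minimise the order over all zeros of `J`: then `h`, the `k`-th derivative along `e`, vanishes
  -- at every zero of `J`, yet has nonzero derivative along `e` at `z₁`.
  have hex : ∃ m, ∃ z ∈ U, J z = 0 ∧ (fun g z => fderiv ℂ g z e)^[m] J z ≠ 0 :=
    ⟨m₀, p, hp, hp0, hm₀⟩
  classical
  obtain ⟨k, hk⟩ : ∃ k, Nat.find hex = k + 1 := by
    refine Nat.exists_eq_succ_of_ne_zero fun h => ?_
    obtain ⟨z, _, hz, hz'⟩ := h ▸ Nat.find_spec hex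
    exact hz' hz
  obtain ⟨z₁, hz₁, hJz₁, hne⟩ := hk ▸ Nat.find_spec hex
  have hmin : ∀ z ∈ U, J z = 0 → (fun g z => fderiv ℂ g z e)^[k] J z = 0 := by
    intro z hz hJz
    by_contra h
    exact Nat.find_min hex (m := k) (by omega) ⟨z, hz, hJz, h⟩
  set h := (fun g z => fderiv ℂ g z e)^[k] J
  have hh : DifferentiableOn ℂ h U := differentiableOn_iterate_fderiv_apply hU hJ e k
  rw [Function.iterate_succ_apply'] at hne
  change fderiv ℂ h z₁ e ≠ 0 at hne
  have he0 : e ≠ 0 := fun h0 => hne (by rw [h0, map_zero])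
  have hlined : ∀ t : ℂ, HasDerivAt (fun t : ℂ => z₁ + t • e) e t := fun t => by
    simpa using ((hasDerivAt_id t).smul_const e).const_add z₁
  have hJline : ¬ ∀ᶠ t in 𝓝 (0 : ℂ), J (z₁ + t • e) = 0 := by
    intro hev
    have hmem : ∀ᶠ t in 𝓝 (0 : ℂ), z₁ + t • e ∈ U :=
      (hlined 0).continuousAt.preimage_mem_nhds (hU.mem_nhds (by simpa using hz₁))
    have hz : (fun t : ℂ => h (z₁ + t • e)) =ᶠ[𝓝 0] fun _ => 0 := by
      filter_upwards [hev, hmem] with t ht htU using hmin _ htU ht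
    have hd : HasFDerivAt h (fderiv ℂ h z₁) (z₁ + (0 : ℂ) • e) := by
      rw [zero_smul, add_zero]
      exact ((hh z₁ hz₁).differentiableAt (hU.mem_nhds hz₁)).hasFDerivAt
    have h1 := (hd.comp_hasDerivAt (0 : ℂ) (hlined 0)).deriv
    have h2 := hz.deriv_eq
    rw [deriv_const] at h2
    exact hne (h1.symm.trans h2)
  -- This is where dimension at least two enters: a second direction for the plane slice through
  -- `z₁`.
  obtain ⟨v, hv⟩ : ∃ v : E, v ∉ Submodule.span ℂ {e} := by
    by_contra! hall
    have := finrank_span_singleton (K := ℂ) he0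
    rw [(Submodule.eq_top_iff'.2 hall), finrank_top] at this
    omega
  let κ : ℂ × ℂ →L[ℂ] E := (ContinuousLinearMap.toSpanSingleton ℂ v).coprod
    (ContinuousLinearMap.toSpanSingleton ℂ e)
  have hκ : ∀ s t, κ (s, t) = s • v + t • e := fun s t => by simp [κ]
  have hz₁κ : z₁ + κ 0 = z₁ := by rw [map_zero, add_zero]
  let H : ℂ × ℂ → ℂ := fun q => h (z₁ + κ q)
  have hHd : HasFDerivAt H (fderiv ℂ h z₁ ∘L κ) 0 := by
    have hd : HasFDerivAt h (fderiv ℂ h z₁) (z₁ + κ 0) := by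
      rw [hz₁κ]
      exact ((hh z₁ hz₁).differentiableAt (hU.mem_nhds hz₁)).hasFDerivAt
    exact hd.comp (f := fun q => z₁ + κ q) 0 (κ.hasFDerivAt.const_add z₁)
  have hH : ContDiffAt ℂ 1 H 0 := by
    have h1 : ContDiffAt ℂ 1 h (z₁ + κ 0) := by
      rw [hz₁κ]; exact contDiffAt_one_of_differentiableOn hU hh hz₁
    exact h1.comp (f := fun q => z₁ + κ q) 0 (contDiffAt_const.add κ.contDiff.contDiffAt)
  have hinv : (fderiv ℂ H 0 ∘L ContinuousLinearMap.inr ℂ ℂ ℂ).IsInvertible := by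
    refine ⟨ContinuousLinearEquiv.unitsEquivAut ℂ (Units.mk0 _ hne), ?_⟩
    rw [hHd.fderiv]
    ext
    simp [hκ]
  obtain ⟨ψ, hψ0, hψd, hψ⟩ : ∃ ψ : ℂ → ℂ, ψ 0 = 0 ∧ ContDiffAt ℂ 1 ψ 0 ∧
      ∀ᶠ q in 𝓝 (0 : ℂ × ℂ), H q = H 0 ↔ ψ q.1 = q.2 :=
    ⟨hH.implicitFunction one_ne_zero hinv, hH.implicitFunction_apply_self one_ne_zero hinv,
      hH.contDiffAt_implicitFunction one_ne_zero hinv,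
      hH.eventually_apply_eq_iff_implicitFunction one_ne_zero hinv⟩
  have hH0 : H 0 = 0 := by simp only [H, hz₁κ]; exact hmin z₁ hz₁ hJz₁
  have hκU : ∀ᶠ q in 𝓝 (0 : ℂ × ℂ), z₁ + κ q ∈ U :=
    (κ.hasFDerivAt.const_add z₁).continuousAt.preimage_mem_nhds (hU.mem_nhds (by rwa [hz₁κ]))
  have hJκ : ∀ᶠ q in 𝓝 (0 : ℂ × ℂ), DifferentiableAt ℂ J (z₁ + κ q) :=
    hκU.mono fun q hq => (hJ _ hq).differentiableAt (hU.mem_nhds hq)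
  have hsz : Tendsto (fun t : ℂ => ((0 : ℂ), t)) (𝓝 0) (𝓝 (0 : ℂ × ℂ)) :=
    (Continuous.prodMk_right (0 : ℂ)).tendsto 0
  have hzero : ∀ V ∈ 𝓝 (0 : ℂ), ∀ᶠ s in 𝓝 (0 : ℂ), ∃ t ∈ V, J (z₁ + κ (s, t)) = 0 := by
    intro V hV
    have hline : ∀ t, z₁ + κ (0, t) = z₁ + t • e := fun t => by rw [hκ]; simp
    refine eventually_exists_zero_of_tendsto (l := 𝓝 (0 : ℂ)) (h := fun s t => J (z₁ + κ (s, t)))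
      (g := fun t => J (z₁ + κ (0, t))) (z₀ := 0) ?_ ?_ ?_ ?_ ?_ hV
    · exact (congrArg J hz₁κ).trans hJz₁
    · filter_upwards [hsz.eventually hJκ] with t ht
      refine ContinuousAt.comp (f := fun t => z₁ + κ (0, t)) ht.continuousAt ?_
      fun_prop
    · have han : AnalyticAt ℂ (fun t => J (z₁ + κ (0, t))) 0 := by
        rw [Complex.analyticAt_iff_eventually_differentiableAt]
        filter_upwards [hsz.eventually hJκ] with t ht
        refine DifferentiableAt.comp (f := fun t => z₁ + κ (0, t)) t ht ?_
        fun_prop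
      refine han.eventually_eq_zero_or_eventually_ne_zero.resolve_left ?_
      simpa only [hline] using hJline
    · rw [← nhds_prod_eq]
      filter_upwards [hJκ] with q hq
      refine DifferentiableAt.comp (f := fun t => z₁ + κ (q.1, t)) q.2 hq ?_
      fun_prop
    · filter_upwards [hsz.eventually hJκ] with t ht
      rw [← nhds_prod_eq]
      have : ContinuousAt (fun q : ℂ × ℂ => J (z₁ + κ q)) (0, t) :=
        ContinuousAt.comp (f := fun q => z₁ + κ q) ht.continuousAt (by fun_prop)
      exact this
  have hψd' : ∀ᶠ s in 𝓝 0, DifferentiableAt ℂ ψ s :=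
    (hψd.eventually (by simp)).mono fun y hy => hy.differentiableAt one_ne_zero
  -- Hurwitz gives a zero of `J` on each nearby line; it is a zero of `h`, hence lies on the graph
  -- of `ψ`.
  have hψJ : ∀ᶠ s in 𝓝 0, z₁ + κ (s, ψ s) ∈ U ∧ J (z₁ + κ (s, ψ s)) = 0 := by
    obtain ⟨pa, hpa, pb, hpb, hpab⟩ := eventually_prod_iff.1
      (show ∀ᶠ q in 𝓝 (0 : ℂ) ×ˢ 𝓝 (0 : ℂ), (H q = H 0 ↔ ψ q.1 = q.2) ∧ z₁ + κ q ∈ U by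
        rw [← nhds_prod_eq]; exact hψ.and hκU)
    filter_upwards [hpa, hzero _ hpb] with s hs ⟨t, ht, hJt⟩
    obtain ⟨h1, h2⟩ := hpab hs ht
    have h3 : ψ s = t := h1.1 ((hmin _ h2 hJt).trans hH0.symm)
    rw [h3]
    exact ⟨h2, hJt⟩
  obtain ⟨r, hr, hball⟩ := Metric.nhds_basis_ball.mem_iff.1 (inter_mem hψd' hψJ)
  -- Along this curve of zeros of `J` the derivative of `f` vanishes by `hsing`.
  have hder : ∀ s ∈ Metric.ball (0 : ℂ) r,
      HasFDerivAt (fun s => f (z₁ + κ (s, ψ s))) (0 : ℂ →L[ℂ] E) s := by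
    intro s hs
    obtain ⟨h1, h2, h3⟩ := hball hs
    have h4 := (hfd _ h2).hasFDerivAt
    rw [hsing _ h2 h3] at h4
    exact h4.comp s ((κ.hasFDerivAt.comp s
      ((hasFDerivAt_id s).prodMk (DifferentiableAt.hasFDerivAt h1))).const_add z₁)
  have h0 : (0 : ℂ) ∈ Metric.ball (0 : ℂ) r := Metric.mem_ball_self hr
  have h1 : ((r / 2 : ℝ) : ℂ) ∈ Metric.ball (0 : ℂ) r := by simp [abs_of_pos hr, hr]
  have hconst := (convex_ball (0 : ℂ) r).is_const_of_fderivWithin_eq_zero (𝕜 := ℂ)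
    (fun s hs => (hder s hs).differentiableAt.differentiableWithinAt)
    (fun s hs => by rw [fderivWithin_of_isOpen Metric.isOpen_ball hs, (hder s hs).fderiv]) h1 h0
  have heq := add_left_cancel (hinj (hball h1).2.1 (hball h0).2.1 hconst)
  rw [hκ, hκ, hψ0, zero_smul, zero_smul, zero_add] at heq
  refine hv (Submodule.mem_span_singleton.2 ⟨-(((r / 2 : ℝ) : ℂ)⁻¹ * ψ (r / 2 : ℝ)), ?_⟩)
  have hrc : ((r / 2 : ℝ) : ℂ) ≠ 0 := by simp [hr.ne']
  rw [← inv_smul_smul₀ hrc v, eq_neg_of_add_eq_zero_left heq, neg_smul, mul_smul, smul_neg]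

end Osgood

/-! ### Linear algebra of kernels and determinants. -/

section

variable {E F : Type*} [NormedAddCommGroup E] [NormedSpace ℂ E]
  [NormedAddCommGroup F] [NormedSpace ℂ F]

theorem finrank_ker_of_apply_eq_one [FiniteDimensional ℂ E] (a : E →L[ℂ] ℂ) {e : E} (he : a e = 1)
    {n : ℕ} (hn : Module.finrank ℂ E = n + 1) : Module.finrank ℂ a.ker = n := by
  have h1 := LinearMap.finrank_range_add_finrank_ker (a : E →ₗ[ℂ] ℂ)
  have h2 : LinearMap.range (a : E →ₗ[ℂ] ℂ) = ⊤ :=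
    LinearMap.range_eq_top.2 fun c => ⟨c • e, by simp [he]⟩
  rw [h2, finrank_top, Module.finrank_self] at h1
  omega

theorem det_ne_zero_iff_injective [FiniteDimensional ℂ E] (A : E →L[ℂ] E) :
    A.det ≠ 0 ↔ Function.Injective A := by
  rw [ContinuousLinearMap.det, ← isUnit_iff_ne_zero, ← LinearMap.isUnit_iff_isUnit_det,
    LinearMap.isUnit_iff_ker_eq_bot, LinearMap.ker_eq_bot]
  rfl

end

-- Osgood's theorem: the induction on dimension.

universe u

/-- If Osgood's theorem holds in dimension `n`, then in dimension `n + 1` the derivative of an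
injective holomorphic map is invertible wherever it is nonzero. -/
theorem injective_fderiv_of_fderiv_ne_zero {n : ℕ}
    (ih : ∀ {E : Type u} {F : Type u} [NormedAddCommGroup E] [NormedSpace ℂ E]
      [FiniteDimensional ℂ E] [NormedAddCommGroup F] [NormedSpace ℂ F] [FiniteDimensional ℂ F],
      Module.finrank ℂ E = n → Module.finrank ℂ F = n → ∀ {U : Set E}, IsOpen U → ∀ {f : E → F},
      DifferentiableOn ℂ f U → InjOn f U → ∀ {p : E}, p ∈ U → Function.Injective (fderiv ℂ f p))
    {E : Type u} {F : Type u} [NormedAddCommGroup E] [NormedSpace ℂ E] [FiniteDimensional ℂ E]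
    [NormedAddCommGroup F] [NormedSpace ℂ F] [FiniteDimensional ℂ F]
    (hE : Module.finrank ℂ E = n + 1) (hF : Module.finrank ℂ F = n + 1) {U : Set E} (hU : IsOpen U)
    {f : E → F} (hf : DifferentiableOn ℂ f U) (hinj : InjOn f U) {p : E} (hp : p ∈ U)
    (hne : fderiv ℂ f p ≠ 0) : Function.Injective (fderiv ℂ f p) := by
  obtain ⟨e, he⟩ : ∃ e, fderiv ℂ f p e ≠ 0 := by
    by_contra! h
    exact hne (ContinuousLinearMap.ext h)
  obtain ⟨l, hl⟩ := SeparatingDual.exists_eq_one (R := ℂ) he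
  exact injective_fderiv_of_ker hU hf hinj hp hl fun V k hV hk hkinj y hy =>
    ih (finrank_ker_of_apply_eq_one (l ∘L fderiv ℂ f p) hl hE)
      (finrank_ker_of_apply_eq_one l hl hF) hV hk hkinj hy

/-- **Osgood's theorem**: an injective holomorphic map between spaces of the same finite dimension
has invertible derivative everywhere. -/
theorem injective_fderiv_of_injOn {n : ℕ} {E F : Type u} [NormedAddCommGroup E] [NormedSpace ℂ E]
    [FiniteDimensional ℂ E] [NormedAddCommGroup F] [NormedSpace ℂ F] [FiniteDimensional ℂ F]
    (hE : Module.finrank ℂ E = n) (hF : Module.finrank ℂ F = n) {U : Set E} (hU : IsOpen U)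
    {f : E → F} (hf : DifferentiableOn ℂ f U) (hinj : InjOn f U) {p : E} (hp : p ∈ U) :
    Function.Injective (fderiv ℂ f p) := by
  -- Source and target stay separate because the induction passes to two different kernels.
  induction n generalizing E F with
  | zero =>
    have := Module.finrank_zero_iff.1 hE
    exact Function.injective_of_subsingleton _
  | succ n ih =>
    have hfp := ((hf p hp).differentiableAt (hU.mem_nhds hp)).hasFDerivAt
    rcases Nat.eq_zero_or_pos n with rfl | hn
    · refine injective_fderiv_of_fderiv_ne_zero ih hE hF hU hf hinj hp fun h0 => ?_
      have : Nontrivial E := Module.nontrivial_of_finrank_pos (R := ℂ) (by omega)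
      obtain ⟨e, he⟩ := exists_ne (0 : E)
      let Φ : F ≃L[ℂ] ℂ := ContinuousLinearEquiv.ofFinrankEq (by rw [hF, Module.finrank_self])
      have hline : ∀ t : ℂ, HasDerivAt (fun t : ℂ => p + t • e) e t := fun t => by
        simpa using ((hasDerivAt_id t).smul_const e).const_add p
      have hcont : Continuous fun t : ℂ => p + t • e := by fun_prop
      have hmem : (0 : ℂ) ∈ (fun t : ℂ => p + t • e) ⁻¹' U := by simpa using hp
      refine deriv_ne_zero_of_injOn (f := fun t => Φ (f (p + t • e))) (hU.preimage hcont)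
        (fun t ht => ?_) (fun s hs t ht hst => ?_) hmem ?_
      · exact (Φ.differentiableAt.comp t (((hf _ ht).differentiableAt (hU.mem_nhds ht)).comp t
          (hline t).differentiableAt)).differentiableWithinAt
      · exact smul_left_injective ℂ he (add_left_cancel (hinj hs ht (Φ.injective hst)))
      · have h1 : HasFDerivAt f (0 : E →L[ℂ] F) (p + (0 : ℂ) • e) := by
          rw [zero_smul, add_zero, ← h0]; exact hfp
        have h2 := Φ.hasFDerivAt.comp_hasDerivAt (0 : ℂ) (h1.comp_hasDerivAt (0 : ℂ) (hline 0))
        exact h2.deriv.trans (by simp)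
    · let Φ : F ≃L[ℂ] E := ContinuousLinearEquiv.ofFinrankEq (by rw [hF, hE])
      have hg : DifferentiableOn ℂ (fun z => Φ (f z)) U := Φ.differentiable.comp_differentiableOn hf
      have hginj : InjOn (fun z => Φ (f z)) U := fun z hz w hw h => hinj hz hw (Φ.injective h)
      have hdet := det_fderiv_ne_zero_of_singular_imp_zero (by omega) hU hg hginj
        (fun z hz hz0 => by
          by_contra hne
          exact (det_ne_zero_iff_injective _).2
            (injective_fderiv_of_fderiv_ne_zero ih hE hE hU hg hginj hz hne) hz0) hp
      have hcomp : fderiv ℂ (fun z => Φ (f z)) p = _ := (Φ.hasFDerivAt.comp p hfp).fderiv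
      rw [det_ne_zero_iff_injective, hcomp] at hdet
      exact Function.Injective.of_comp hdet

/-! ### Limits of injective holomorphic maps. -/

section

variable {E : Type*} [NormedAddCommGroup E] [NormedSpace ℂ E]

/-- If the image of an injective holomorphic map contains a ball around the image of `x`, then its
derivative at `x` is bounded below in terms of the sizes of the domain and of the ball. -/
theorem norm_le_mul_norm_fderiv_apply [FiniteDimensional ℂ E] {D : Set E}
    (hD : IsOpen D) {x : E} (hx : x ∈ D) {R r : ℝ}
    (hr : 0 < r) (hDR : D ⊆ Metric.closedBall x R) {f : E → E} (hf : DifferentiableOn ℂ f D)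
    (hinj : InjOn f D) (hball : Metric.ball (f x) r ⊆ f '' D) (v : E) :
    ‖v‖ ≤ R / r * ‖fderiv ℂ f x v‖ := by
  have : CompleteSpace E := FiniteDimensional.complete ℂ E
  have hleft : LeftInvOn (Function.invFunOn f D) f D := hinj.leftInvOn_invFunOn
  -- Osgood's theorem makes the global inverse holomorphic, so the Cauchy estimate applies to it.
  have hg : ∀ a ∈ D, ∃ A : E ≃L[ℂ] E, (A : E →L[ℂ] E) = fderiv ℂ f a ∧
      HasFDerivAt (Function.invFunOn f D) (A.symm : E →L[ℂ] E) (f a) := by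
    intro a ha
    let A : E ≃L[ℂ] E := (LinearEquiv.ofInjectiveEndo (fderiv ℂ f a : E →ₗ[ℂ] E)
      (injective_fderiv_of_injOn rfl rfl hD hf hinj ha)).toContinuousLinearEquiv
    have hA : (A : E →L[ℂ] E) = fderiv ℂ f a := by ext; rfl
    have hs : HasStrictFDerivAt f (A : E →L[ℂ] E) a := by
      rw [hA]; exact hasStrictFDerivAt_of_differentiableOn hD hf ha
    exact ⟨A, hA, (hs.to_local_left_inverse
      (eventually_of_mem (hD.mem_nhds ha) hleft)).hasFDerivAt⟩
  obtain ⟨A, hA, hAd⟩ := hg x hx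
  have hle := Complex.norm_fderiv_le_div_of_mapsTo_ball (f := Function.invFunOn f D) (c := f x)
    (R₁ := r) (R₂ := R) (fun w hw => by
      obtain ⟨a, ha, rfl⟩ := hball hw
      obtain ⟨_, _, h⟩ := hg a ha
      exact h.differentiableAt.differentiableWithinAt) (fun w hw => by
      obtain ⟨a, ha, rfl⟩ := hball hw
      rw [hleft ha, hleft hx]
      exact hDR ha) hr
  rw [hAd.fderiv] at hle
  have h1 : (A.symm : E →L[ℂ] E) (fderiv ℂ f x v) = v := by
    rw [← hA]; exact A.symm_apply_apply v
  calc ‖v‖ = ‖(A.symm : E →L[ℂ] E) (fderiv ℂ f x v)‖ := by rw [h1]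
    _ ≤ ‖(A.symm : E →L[ℂ] E)‖ * ‖fderiv ℂ f x v‖ := ContinuousLinearMap.le_opNorm _ _
    _ ≤ R / r * ‖fderiv ℂ f x v‖ := by gcongr

/-- If the maps `G i` and their derivatives converge near `a`, with invertible limit derivative,
then every neighbourhood of `a` is eventually mapped onto the limit value. -/
theorem eventually_mem_image_of_tendsto_fderiv [CompleteSpace E] [Nontrivial E] {ι : Type*}
    {l : Filter ι} {G : ι → E → E} {a c : E} {A : E ≃L[ℂ] E}
    (hd : ∀ᶠ p in l ×ˢ 𝓝 a, DifferentiableAt ℂ (G p.1) p.2)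
    (hlim : Tendsto (fun p : ι × E => fderiv ℂ (G p.1) p.2) (l ×ˢ 𝓝 a) (𝓝 (A : E →L[ℂ] E)))
    (hc : Tendsto (fun i => G i a) l (𝓝 c)) {V : Set E} (hV : V ∈ 𝓝 a) :
    ∀ᶠ i in l, c ∈ G i '' V := by
  set N := ‖(A.symm : E →L[ℂ] E)‖₊
  have hN : 0 < N := A.nnnorm_symm_pos
  -- Closeness below `N⁻¹` gives surjectivity onto a ball about `G i a` whose radius does not depend
  -- on `i`.
  have hε : 0 < N⁻¹ / 2 := half_pos (inv_pos.2 hN)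
  have hclose : ∀ᶠ p in l ×ˢ 𝓝 a, ‖fderiv ℂ (G p.1) p.2 - A‖ < (N⁻¹ / 2 : NNReal) := by
    simpa [dist_eq_norm] using Metric.tendsto_nhds.1 hlim (N⁻¹ / 2 : NNReal) hε
  obtain ⟨pa, hpa, pb, hpb, hpab⟩ := eventually_prod_iff.1 (hd.and hclose)
  obtain ⟨ρ, hρ, hball⟩ := Metric.nhds_basis_closedBall.mem_iff.1 (inter_mem hpb hV)
  have hρ' : 0 < ((N : ℝ)⁻¹ - (N⁻¹ / 2 : NNReal)) * ρ := by
    refine mul_pos ?_ hρ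
    have : (0 : ℝ) < (N : ℝ)⁻¹ := inv_pos.2 hN
    push_cast
    linarith
  filter_upwards [hpa, Metric.tendsto_nhds.1 hc _ hρ'] with i hi hci
  have happ : ApproximatesLinearOn (G i) (A : E →L[ℂ] E) (Metric.closedBall a ρ) (N⁻¹ / 2) :=
    fun y hy z hz => (convex_closedBall a ρ).norm_image_sub_le_of_norm_fderiv_le' (𝕜 := ℂ)
      (fun w hw => (hpab hi (hball hw).1).1) (fun w hw => (hpab hi (hball hw).1).2.le) hz hy
  have hsurj := happ.surjOn_closedBall_of_nonlinearRightInverse A.toNonlinearRightInverse hρ.le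
    Subset.rfl
  obtain ⟨z, hz, hzc⟩ := hsurj (show c ∈ _ from Metric.mem_closedBall'.2 hci.le)
  exact ⟨z, (hball hz).2, hzc⟩

/-- A limit of injective holomorphic maps is injective if its derivative is invertible
everywhere. -/
theorem injOn_of_tendsto_fderiv [FiniteDimensional ℂ E] {D : Set E}
    (hD : IsOpen D) {ι : Type*} {l : Filter ι} [l.NeBot]
    {G : ι → E → E} {g : E → E} (hG : ∀ i, DifferentiableOn ℂ (G i) D)
    (hinj : ∀ i, InjOn (G i) D) (hlim : ∀ z ∈ D, Tendsto (fun i => G i z) l (𝓝 (g z)))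
    (hlim' : ∀ z ∈ D, Tendsto (fun p : ι × E => fderiv ℂ (G p.1) p.2) (l ×ˢ 𝓝 z)
      (𝓝 (fderiv ℂ g z)))
    (hg : ∀ z ∈ D, Function.Injective (fderiv ℂ g z)) : InjOn g D := by
  intro a ha b hb hab
  by_contra hne
  have : CompleteSpace E := FiniteDimensional.complete ℂ E
  have : Nontrivial E := ⟨a, b, hne⟩
  obtain ⟨V, W, hV, hW, haV, hbW, hVW⟩ := t2_separation hne
  have key : ∀ z ∈ D, ∀ T ∈ 𝓝 z, ∀ᶠ i in l, g z ∈ G i '' (T ∩ D) := by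
    intro z hz T hT
    let A : E ≃L[ℂ] E := (LinearEquiv.ofInjectiveEndo (fderiv ℂ g z : E →ₗ[ℂ] E)
      (hg z hz)).toContinuousLinearEquiv
    have hA : (A : E →L[ℂ] E) = fderiv ℂ g z := by ext; rfl
    refine eventually_mem_image_of_tendsto_fderiv (A := A) ?_ (by rw [hA]; exact hlim' z hz)
      (hlim z hz) (inter_mem hT (hD.mem_nhds hz))
    exact ((hD.eventually_mem hz).prod_inr l).mono fun p hp =>
      (hG p.1 p.2 hp).differentiableAt (hD.mem_nhds hp)
  obtain ⟨i, ⟨a', ha', haa⟩, b', hb', hbb⟩ :=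
    ((key a ha V (hV.mem_nhds haV)).and (key b hb W (hW.mem_nhds hbW))).exists
  have : a' = b' := hinj i ha'.2 hb'.2 (by rw [haa, hbb, hab])
  exact disjoint_left.1 hVW ha'.1 (this ▸ hb'.1)

/-- If the Jacobian determinants of a convergent family of holomorphic maps vanish nowhere, then
the Jacobian determinant of the limit vanishes everywhere or nowhere. -/
theorem det_fderiv_ne_zero_of_tendsto [FiniteDimensional ℂ E] {D : Set E}
    (hD : IsOpen D) (hDc : IsPreconnected D)
    {ι : Type*} {l : Filter ι} [l.NeBot] {G : ι → E → E} {g : E → E}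
    (hG : ∀ i, DifferentiableOn ℂ (G i) D) (hg : DifferentiableOn ℂ g D)
    (hlim : ∀ z ∈ D, Tendsto (fun p : ι × E => fderiv ℂ (G p.1) p.2) (l ×ˢ 𝓝 z)
      (𝓝 (fderiv ℂ g z)))
    (hdet : ∀ i, ∀ z ∈ D, (fderiv ℂ (G i) z).det ≠ 0) {x : E} (hx : x ∈ D)
    (hgx : (fderiv ℂ g x).det ≠ 0) {z : E} (hz : z ∈ D) : (fderiv ℂ g z).det ≠ 0 := by
  set J : E → ℂ := fun z => (fderiv ℂ g z).det
  have hJ : DifferentiableOn ℂ J D := differentiableOn_det_fderiv hD hg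
  have hJd : ∀ z ∈ D, DifferentiableAt ℂ J z := fun z hz =>
    (hJ z hz).differentiableAt (hD.mem_nhds hz)
  -- An isolated zero of `J` on a line through `p` would, by Hurwitz, produce zeros of the Jacobians
  -- of `G i`.
  have hlocal : ∀ p ∈ D, J p = 0 → ∀ᶠ q in 𝓝 p, J q = 0 := by
    intro p hp hp0
    obtain ⟨r, hr, hball⟩ := Metric.nhds_basis_ball.mem_iff.1 (hD.mem_nhds hp)
    refine eventually_of_mem (Metric.ball_mem_nhds p hr) fun q hq => ?_
    have hpp := Metric.mem_ball_self (x := p) hr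
    refine eq_zero_of_eventually_eq_zero_on_line Metric.isOpen_ball (convex_ball p r)
      (hJ.mono hball) hpp hq ?_
    have hline : Differentiable ℂ fun t : ℂ => p + t • (q - p) := by fun_prop
    have hmem : ∀ᶠ t in 𝓝 (0 : ℂ), p + t • (q - p) ∈ D :=
      hline.continuous.continuousAt.preimage_mem_nhds (hD.mem_nhds (by simpa using hp))
    have hdl : ∀ᶠ t in 𝓝 (0 : ℂ), DifferentiableAt ℂ (fun t : ℂ => J (p + t • (q - p))) t :=
      hmem.mono fun t ht => DifferentiableAt.comp (g := J) t (hJd _ ht) (hline t)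
    have han : AnalyticAt ℂ (fun t : ℂ => J (p + t • (q - p))) 0 :=
      Complex.analyticAt_iff_eventually_differentiableAt.2 hdl
    refine han.eventually_eq_zero_or_eventually_ne_zero.resolve_right fun hne => ?_
    have hev := eventually_exists_zero_of_tendsto (l := l)
      (h := fun i t => (fderiv ℂ (G i) (p + t • (q - p))).det)
      (g := fun t => J (p + t • (q - p))) (by simpa using hp0)
      (hdl.mono fun t ht => ht.continuousAt) hne
      ((hmem.prod_inr l).mono fun s hs =>
        DifferentiableAt.comp (g := fun z => (fderiv ℂ (G s.1) z).det) s.2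
        ((differentiableOn_det_fderiv hD (hG s.1) _ hs).differentiableAt (hD.mem_nhds hs))
        (hline s.2))
      (hmem.mono fun t ht => (ContinuousLinearMap.continuous_det.tendsto _).comp
        ((hlim _ ht).comp (tendsto_fst.prodMk ((hline.continuous.tendsto t).comp tendsto_snd))))
      hmem
    obtain ⟨i, t, ht, hzero⟩ := hev.exists
    exact hdet i _ ht hzero
  intro hz0
  -- The points near which `J` vanishes form an open, relatively closed subset of `D`.
  have hsub : D ⊆ {q | ∀ᶠ w in 𝓝 q, J w = 0} := by
    refine hDc.subset_of_closure_inter_subset isOpen_setOfPred_eventually_nhds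
      ⟨z, hz, hlocal z hz hz0⟩ fun q hq => hlocal q hq.2 ?_
    by_contra hne
    obtain ⟨w, hw1, hw2⟩ := ((mem_closure_iff_frequently.1 hq.1).and_eventually
      ((hJd q hq.2).continuousAt.eventually_ne hne)).exists
    exact hw2 hw1.self_of_nhds
  exact hgx (hsub hx).self_of_nhds

end

/-! ### Injectivity of the limit. -/

theorem mainTheorem2 (n : ℕ)
    (D : Set (EuclideanSpace ℂ (Fin n)))
    (hD_open : IsOpen D) (hD_conn : IsConnected D) (hD_bdd : Bornology.IsBounded D)
    (x : EuclideanSpace ℂ (Fin n)) (hx : x ∈ D)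
    (F : ℕ → EuclideanSpace ℂ (Fin n) → EuclideanSpace ℂ (Fin n))
    (hF_holo : ∀ i, DifferentiableOn ℂ (F i) D)
    (hF_inj : ∀ i, InjOn (F i) D)
    (hF_zero : ∀ i, F i x = 0)
    (f : EuclideanSpace ℂ (Fin n) → EuclideanSpace ℂ (Fin n))
    (hf : ∀ K : Set (EuclideanSpace ℂ (Fin n)), K ⊆ D → IsCompact K →
      TendstoUniformlyOn F f atTop K)
    (U : Set (EuclideanSpace ℂ (Fin n))) (hU : U ∈ 𝓝 0)
    (hUF : ∀ i, U ⊆ F i '' D) :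
    InjOn f D := by
  have : ProperSpace (EuclideanSpace ℂ (Fin n)) := FiniteDimensional.proper ℂ _
  have hlim : ∀ z ∈ D, Tendsto (fun i => F i z) atTop (𝓝 (f z)) := fun z hz =>
    (hf {z} (singleton_subset_iff.2 hz) isCompact_singleton).tendsto_at rfl
  have hder : ∀ z ∈ D, DifferentiableAt ℂ f z ∧ Tendsto
      (fun p : ℕ × EuclideanSpace ℂ (Fin n) => fderiv ℂ (F p.1) p.2) (atTop ×ˢ 𝓝 z)
        (𝓝 (fderiv ℂ f z)) := by
    intro z hz
    obtain ⟨r, hr, hball⟩ := Metric.nhds_basis_closedBall.mem_iff.1 (hD_open.mem_nhds hz)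
    exact hasFDerivAt_and_tendsto_fderiv_of_tendstoUniformlyOn hr
      (Eventually.of_forall fun i => (hF_holo i).mono (Metric.ball_subset_closedBall.trans hball))
      ((hf _ hball (isCompact_closedBall z r)).mono Metric.ball_subset_closedBall)
  obtain ⟨r, hr, hrU⟩ := Metric.nhds_basis_ball.mem_iff.1 hU
  obtain ⟨R, hR⟩ := hD_bdd.subset_closedBall x
  have hfx : Function.Injective (fderiv ℂ f x) := by
    rw [injective_iff_map_eq_zero]
    intro v hv
    have h1 : Tendsto (fun i => fderiv ℂ (F i) x) atTop (𝓝 (fderiv ℂ f x)) :=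
      (hder x hx).2.comp (tendsto_id.prodMk tendsto_const_nhds)
    have h2 : Tendsto (fun i => R / r * ‖fderiv ℂ (F i) x v‖) atTop
        (𝓝 (R / r * ‖fderiv ℂ f x v‖)) :=
      (((ContinuousLinearMap.apply ℂ _ v).continuous.tendsto _).comp h1).norm.const_mul _
    -- The constant `R / r` is independent of `i`, so the lower bound survives the limit.
    have h3 : ‖v‖ ≤ R / r * ‖fderiv ℂ f x v‖ := ge_of_tendsto' h2 fun i =>
      norm_le_mul_norm_fderiv_apply hD_open hx hr hR (hF_holo i) (hF_inj i)
        (by rw [hF_zero i]; exact hrU.trans (hUF i)) v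
    simpa [hv] using h3
  refine injOn_of_tendsto_fderiv hD_open hF_holo hF_inj hlim (fun z hz => (hder z hz).2)
    fun z hz => (det_ne_zero_iff_injective _).1 ?_
  exact det_fderiv_ne_zero_of_tendsto hD_open hD_conn.isPreconnected hF_holo
    (fun z hz => (hder z hz).1.differentiableWithinAt) (fun z hz => (hder z hz).2)
    (fun i z hz => (det_ne_zero_iff_injective _).2
      (injective_fderiv_of_injOn rfl rfl hD_open (hF_holo i) (hF_inj i) hz))
    hx ((det_ne_zero_iff_injective _).2 hfx) hz
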